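/- Let $m>2$ be an integer, let $\omega\in\mathbb{C}$ be a primitive $m$-th root of unity, put $\bar\omega=1/\omega$, and let $q\in\mathbb{C}$ with $|q|<1$. Write $(a;q)_j=\prod_{k=0}^{j-1}(1-aq^k)$. For integers $j,k\ge 0$ and $i\in\mathbb{Z}$ let $$F_k(\omega,i,j,q)=\sum_{0\le u\le (mk+i)/2}c_{u}\,(q^{u+1};q)_j,\qquad c_u=\begin{cases}1,&2u=mk+i,\\ \omega^{2u-i}+\omega^{i-2u},&\text{otherwise}\end{cases}$$ (an empty sum is $0$). Then the limit $F(\omega,i,j,q)=\lim_{k\to\infty}F_k(\omega,i,j,q)$ exists in $\mathbb{C}$ for all $i\in\mathbb{Z}$ and $j\ge 0$, and for $1\le i\le m$ $$\lim_{k\to\infty}\;\cfrac{1}{\omega+\bar\omega+q-\cfrac{1}{\omega+\bar\omega+q^2-\cdots-\cfrac{1}{\omega+\bar\omega+q^{mk+i-1}}}} =\frac{\displaystyle\sum_{j=0}^{\infty}\frac{q^{j(j+3)/2}}{(q;q)_j^2}F(\omega,i-j-2,j,q)}{\displaystyle\sum_{j=0}^{\infty}\frac{q^{j(j+1)/2}}{(q;q)_j^2}F(\omega,i-j-1,j,q)}.$$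 Here approximants and limits are taken in the extended complex plane $\hat{\mathbb{C}}=\mathbb{C}\cup\{\infty\}$; the two series converge absolutely, and their sums are not both $0$ (the quotient is $\infty$ if the denominator is $0$). Moreover, the infinite continued fraction $$\frac{1}{\omega+\bar\omega+q}\,{\genfrac{}{}{0pt}{}{}{-}}\,\frac{1}{\omega+\bar\omega+q^2}\,{\genfrac{}{}{0pt}{}{}{-}}\,\frac{1}{\omega+\bar\omega+q^3}\,{\genfrac{}{}{0pt}{}{}{-}}\cdots$$ has rank $m$ if $m$ is odd, and rank $m/2$ if $m$ is even. Having rank $r$ means that, for each of the $r$ residue classes modulo $r$, the approximants with index in that class converge in $\hat{\mathbb{C}}$, and that the $r$ limits are pairwise distinct. -/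

import Mathlib

open Filter Topology

noncomputable section

/-- The `q`-Pochhammer symbol `(a; q)_j = ∏_{k < j} (1 - a q^k)`. -/
def qPoch (a q : ℂ) (j : ℕ) : ℂ :=
  ∏ k ∈ Finset.range j, (1 - a * q ^ k)

/-- The quotient `a / b` in the extended complex plane, with `a / 0 = ∞`
(only used for pairs `(a, b) ≠ (0, 0)`). -/
def extDiv (a b : ℂ) : OnePoint ℂ :=
  open Classical in if b = 0 then OnePoint.infty else ((a / b : ℂ) : OnePoint ℂ)

/-- The `N`-th approximant `P_N / Q_N` of a continued fraction, as a point of the extended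
complex plane; `P_N` and `Q_N` are the canonical numerators and denominators. -/
def approximant (g : GenContFract ℂ) (N : ℕ) : OnePoint ℂ :=
  extDiv (g.nums N) (g.dens N)

/-- The continued fraction `g` has rank `r`: its approximants converge in the extended complex
plane along each of the `r` residue classes modulo `r`, and the `r` limits are distinct. -/
def HasRank (g : GenContFract ℂ) (r : ℕ) : Prop :=
  0 < r ∧ ∃ L : Fin r → OnePoint ℂ, Function.Injective L ∧
    ∀ i : Fin r, Tendsto (fun k : ℕ => approximant g (r * k + i)) atTop (𝓝 (L i))

/-- The continued fraction
`1 / (ω + ω⁻¹ + q) - 1 / (ω + ω⁻¹ + q ^ 2) - 1 / (ω + ω⁻¹ + q ^ 3) - ⋯`.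
Its `n`-th partial quotient, counted from `n = 0`, has numerator `1` if `n = 0` and `-1`
otherwise, and denominator `ω + ω⁻¹ + q ^ (n + 1)`. -/
def ramanujanCF (ω q : ℂ) : GenContFract ℂ where
  h := 0
  s := Stream'.Seq.ofStream fun n : ℕ =>
    ⟨if n = 0 then 1 else -1, ω + ω⁻¹ + q ^ (n + 1)⟩

/-- `F_k(ω, i, j, q)`: the sum over `0 ≤ u ≤ ⌊(m k + i) / 2⌋` (empty if `m k + i < 0`) of
`(q^{u+1}; q)_j (ω^{2u-i} + ω^{i-2u})`, where for `m k + i` even the final term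
(`2 u = m k + i`) is `(q^{u+1}; q)_j` instead. -/
def Fpartial (m : ℕ) (ω : ℂ) (i : ℤ) (j : ℕ) (q : ℂ) (k : ℕ) : ℂ :=
  ∑ u ∈ Finset.range (((m : ℤ) * k + i) / 2 + 1).toNat,
    if 2 * (u : ℤ) = (m : ℤ) * k + i then qPoch (q ^ (u + 1)) q j
    else qPoch (q ^ (u + 1)) q j * (ω ^ (2 * (u : ℤ) - i) + ω ^ (i - 2 * (u : ℤ)))

/-- `F(ω, i, j, q) = lim_{k → ∞} F_k(ω, i, j, q)`. -/
def Flim (m : ℕ) (ω : ℂ) (i : ℤ) (j : ℕ) (q : ℂ) : ℂ :=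
  limUnder atTop (Fpartial m ω i j q)

/-- The `j`-th term `q^{j(j+3)/2} / (q; q)_j^2 * F(ω, i-j-2, j, q)` of the numerator series. -/
def numTerm (m : ℕ) (ω q : ℂ) (i : ℤ) (j : ℕ) : ℂ :=
  q ^ (j * (j + 3) / 2) / qPoch q q j ^ 2 * Flim m ω (i - j - 2) j q

/-- The `j`-th term `q^{j(j+1)/2} / (q; q)_j^2 * F(ω, i-j-1, j, q)` of the denominator series. -/
def denTerm (m : ℕ) (ω q : ℂ) (i : ℤ) (j : ℕ) : ℂ :=
  q ^ (j * (j + 1) / 2) / qPoch q q j ^ 2 * Flim m ω (i - j - 1) j q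

end

noncomputable section

/-! The numerators and denominators of the approximants satisfy `D_{n+2} = (ω + ω⁻¹ + q^{n+1+s})
D_{n+1} - D_n`, with `s = 1` for denominators and `s = 2` for numerators shifted by one index. For
the generating function `G(t) = ∑ D_n t^n` this reads `(1 - ωt)(1 - ω⁻¹t) G(t) = 1 + q^s t G(qt)`.
Iteration gives `G` as a sum of terms `q^{sj + j(j-1)/2} t^j / ((ωt; q)_{j+1} (ω⁻¹t; q)_{j+1})`, and
the q-binomial expansion yields the closed form `cfSol`.

Let `n → ∞` with `ω^n = ω^i`. Each convolution in the closed form splits into a Chebyshev sum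
depending only on `ω^n`, a part tending to an absolutely convergent series, and an error of size
`n|q|^n` (`tendsto_convSum`). Folding the Chebyshev sum about its middle shows that `F_k` has the
same limit (`tendsto_half_sum`). The Gaussian decay of the weights permits passing to the limit
under the sum over `j` (`tendsto_cfSol`).

The identity `P_{n+1} Q_n - P_n Q_{n+1} = 1` survives in the limit, so the two limits never vanish
together. The limits obey the recurrence with `q^n` replaced by `0`, so the cross determinant of
classes `i` and `i + l` is `(ω^l - ω^{-l}) / (ω - ω⁻¹)` (`det_cfLim`). It vanishes exactly when `m ∣
2l`, which decides which classes share a limit and hence the rank. -/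

theorem qPoch_succ (a q : ℂ) (j : ℕ) : qPoch a q (j + 1) = qPoch a q j * (1 - a * q ^ j) :=
  Finset.prod_range_succ _ _

theorem qPoch_succ_left (a q : ℂ) (j : ℕ) :
    qPoch a q (j + 1) = (1 - a) * qPoch (a * q) q j := by
  simp only [qPoch, Finset.prod_range_succ', pow_zero, mul_one]
  rw [mul_comm]
  congr 1
  exact Finset.prod_congr rfl fun k _ => by ring

theorem one_sub_pow_ne_zero {q : ℂ} (hq : ‖q‖ < 1) (k : ℕ) : 1 - q ^ (k + 1) ≠ 0 := by
  intro h
  have h1 : ‖q ^ (k + 1)‖ = 1 := by rw [← sub_eq_zero.mp h]; simp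
  rw [norm_pow] at h1
  exact absurd h1 (pow_lt_one₀ (norm_nonneg _) hq (by omega)).ne

theorem qPoch_self_ne_zero {q : ℂ} (hq : ‖q‖ < 1) (j : ℕ) : qPoch q q j ≠ 0 :=
  Finset.prod_ne_zero_iff.mpr fun k _ => by
    simpa [pow_succ'] using one_sub_pow_ne_zero hq k

/-! ### Gaussian binomials and their generating series -/

/-- The Gaussian binomial coefficient `[a + j, j]_q`. -/
def gaussBinom (q : ℂ) (a j : ℕ) : ℂ := qPoch (q ^ (a + 1)) q j / qPoch q q j

theorem gaussBinom_zero_left {q : ℂ} (hq : ‖q‖ < 1) (j : ℕ) : gaussBinom q 0 j = 1 := by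
  simp [gaussBinom, qPoch_self_ne_zero hq]

/-- After removing the common factor `(q^{a+2}; q)_j`, this is `(1 - q^{a+j+2}) - (1 - q^{a+1}) =
q^{a+1} (1 - q^{j+1})`. -/
theorem gaussBinom_pascal {q : ℂ} (hq : ‖q‖ < 1) (a j : ℕ) :
    gaussBinom q (a + 1) (j + 1) - gaussBinom q a (j + 1) =
      q ^ (a + 1) * gaussBinom q (a + 1) j := by
  have h1 := qPoch_self_ne_zero hq j
  have h2 := qPoch_self_ne_zero hq (j + 1)
  have h3 : qPoch q q (j + 1) = qPoch q q j * (1 - q ^ (j + 1)) := by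
    rw [qPoch_succ]; ring
  have h4 := one_sub_pow_ne_zero hq j
  unfold gaussBinom
  rw [h3, qPoch_succ_left (q ^ (a + 1)), qPoch_succ (q ^ (a + 1 + 1)), ← pow_succ]
  field_simp
  ring

/-- `∑ [a + j, j]_q x ^ a t ^ a`, the expansion of `1 / (x t; q)_{j + 1}`. -/
def qGeomSeries (q x : ℂ) (j : ℕ) : PowerSeries ℂ :=
  PowerSeries.mk fun a => gaussBinom q a j * x ^ a

theorem one_sub_mul_qGeomSeries_zero (q x : ℂ) :
    (1 - PowerSeries.C x * PowerSeries.X) * qGeomSeries q x 0 = 1 := by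
  ext n
  rw [sub_mul, one_mul, mul_assoc, map_sub, PowerSeries.coeff_C_mul]
  cases n with
  | zero => simp [qGeomSeries, gaussBinom, qPoch]
  | succ n =>
    rw [PowerSeries.coeff_succ_X_mul]
    simp [qGeomSeries, gaussBinom, qPoch, PowerSeries.coeff_one]
    ring

theorem one_sub_mul_qGeomSeries_succ {q : ℂ} (hq : ‖q‖ < 1) (x : ℂ) (j : ℕ) :
    (1 - PowerSeries.C x * PowerSeries.X) * qGeomSeries q x (j + 1) =
      PowerSeries.rescale q (qGeomSeries q x j) := by
  ext n
  rw [sub_mul, one_mul, mul_assoc, map_sub, PowerSeries.coeff_C_mul]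
  cases n with
  | zero => simp [qGeomSeries, gaussBinom_zero_left hq]
  | succ n =>
    rw [PowerSeries.coeff_succ_X_mul, PowerSeries.coeff_rescale]
    simp only [qGeomSeries, PowerSeries.coeff_mk]
    linear_combination x ^ (n + 1) * gaussBinom_pascal hq n j

/-- The coefficient sum `∑_{a + b = n} (q^{a+1}; q)_j (q^{b+1}; q)_j ω^{a-b}`. -/
def convSum (ω q : ℂ) (n j : ℕ) : ℂ :=
  ∑ p ∈ Finset.HasAntidiagonal.antidiagonal n,
    qPoch (q ^ (p.1 + 1)) q j * qPoch (q ^ (p.2 + 1)) q j * (ω ^ p.1 * ω⁻¹ ^ p.2)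

theorem coeff_qGeomSeries_mul (ω q : ℂ) (n j : ℕ) :
    PowerSeries.coeff n (qGeomSeries q ω j * qGeomSeries q ω⁻¹ j) =
      convSum ω q n j / qPoch q q j ^ 2 := by
  rw [PowerSeries.coeff_mul, convSum, Finset.sum_div]
  refine Finset.sum_congr rfl fun p _ => ?_
  simp only [qGeomSeries, gaussBinom, PowerSeries.coeff_mk]
  ring

/-! ### Closed form for the three-term recurrence -/

/-- `q^{sj + j(j-1)/2} / (q; q)_j ^ 2`. -/
def cfWeight (q : ℂ) (s j : ℕ) : ℂ := q ^ (s * j + j.choose 2) / qPoch q q j ^ 2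

/-- The solution of `D_{n+2} = (ω + ω⁻¹ + q^{n+1+s}) D_{n+1} - D_n` given by
`∑_j q^{sj + j(j-1)/2} t^j / ((ωt; q)_{j+1} (ω⁻¹t; q)_{j+1})`. -/
def cfSol (ω q : ℂ) (s n : ℕ) : ℂ :=
  ∑ j ∈ Finset.range (n + 1), cfWeight q s j * convSum ω q (n - j) j

/-- A truncation of the generating function of `cfSol`. -/
def cfSeries (ω q : ℂ) (s N : ℕ) : PowerSeries ℂ :=
  ∑ j ∈ Finset.range N, PowerSeries.C (q ^ (s * j + j.choose 2)) *
    (PowerSeries.X ^ j * (qGeomSeries q ω j * qGeomSeries q ω⁻¹ j))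

/-- The `j`-th summand starts in degree `j`, so a finite truncation suffices and no infinite sum of
power series is needed. -/
theorem coeff_cfSeries (ω q : ℂ) (s : ℕ) {n N : ℕ} (h : n < N) :
    PowerSeries.coeff n (cfSeries ω q s N) = cfSol ω q s n := by
  rw [cfSeries, map_sum, cfSol]
  symm
  refine Finset.sum_subset_zero_on_sdiff (Finset.range_mono h) ?_ ?_
  · intro j hj
    simp only [Finset.mem_sdiff, Finset.mem_range] at hj
    rw [PowerSeries.coeff_C_mul, PowerSeries.coeff_X_pow_mul', if_neg (by omega), mul_zero]
  · intro j hj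
    rw [Finset.mem_range] at hj
    rw [PowerSeries.coeff_C_mul, PowerSeries.coeff_X_pow_mul', if_pos (by omega),
      coeff_qGeomSeries_mul, cfWeight]
    ring

theorem rescale_C (q x : ℂ) :
    PowerSeries.rescale q (PowerSeries.C x) = (PowerSeries.C x : PowerSeries ℂ) := by
  ext n
  rw [PowerSeries.coeff_rescale, PowerSeries.coeff_C]
  split_ifs with h <;> simp [h]

/-- The quadratic is `(1 - ωt)(1 - ω⁻¹t)`. It turns the summand `j = 0` into `1`, and strips one
factor from each Pochhammer product in summand `j + 1`, leaving `q^s t` times summand `j` at `qt`.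
-/
theorem quadratic_mul_cfSeries {ω q : ℂ} (hω : ω ≠ 0) (hq : ‖q‖ < 1) (s N : ℕ) :
    (1 - PowerSeries.C (ω + ω⁻¹) * PowerSeries.X + PowerSeries.X ^ 2) * cfSeries ω q s (N + 1) =
      1 + PowerSeries.C (q ^ s) * (PowerSeries.X * PowerSeries.rescale q (cfSeries ω q s N)) := by
  have hfac : (1 - PowerSeries.C (ω + ω⁻¹) * PowerSeries.X + PowerSeries.X ^ 2 : PowerSeries ℂ) =
      (1 - PowerSeries.C ω * PowerSeries.X) * (1 - PowerSeries.C ω⁻¹ * PowerSeries.X) := by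
    have : (PowerSeries.C ω * PowerSeries.C ω⁻¹ : PowerSeries ℂ) = 1 := by
      rw [← map_mul, mul_inv_cancel₀ hω, map_one]
    rw [map_add]
    linear_combination (-PowerSeries.X ^ 2) * this
  rw [hfac, cfSeries, Finset.sum_range_succ', mul_add, add_comm]
  congr 1
  · have h1 := one_sub_mul_qGeomSeries_zero q ω
    have h2 := one_sub_mul_qGeomSeries_zero q ω⁻¹
    simp only [mul_zero, Nat.choose_zero_succ, add_zero, pow_zero, map_one, one_mul]
    linear_combination (1 - PowerSeries.C ω⁻¹ * PowerSeries.X) * qGeomSeries q ω⁻¹ 0 * h1 + h2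
  · rw [cfSeries, map_sum, Finset.mul_sum, Finset.mul_sum, Finset.mul_sum]
    refine Finset.sum_congr rfl fun j _ => ?_
    have h1 := one_sub_mul_qGeomSeries_succ hq ω j
    have h2 := one_sub_mul_qGeomSeries_succ hq ω⁻¹ j
    have hr : PowerSeries.rescale q (PowerSeries.C (q ^ (s * j + j.choose 2)) *
        (PowerSeries.X ^ j * (qGeomSeries q ω j * qGeomSeries q ω⁻¹ j))) =
        PowerSeries.C (q ^ (s * j + j.choose 2)) * (PowerSeries.C (q ^ j) * PowerSeries.X ^ j *
          (PowerSeries.rescale q (qGeomSeries q ω j) *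
            PowerSeries.rescale q (qGeomSeries q ω⁻¹ j))) := by
      simp only [map_mul, map_pow, PowerSeries.rescale_X, rescale_C, mul_pow]
    rw [hr, ← h1, ← h2]
    -- The extra `s` is the prefactor `q^s`; the extra `j` comes from rescaling `t^j`.
    have he : s * (j + 1) + (j + 1).choose 2 = s + j + (s * j + j.choose 2) := by
      rw [Nat.choose_succ_succ' j 1, Nat.choose_one_right]; ring
    rw [he, pow_add, pow_add, map_mul, map_mul]
    ring

theorem cfSol_zero (ω q : ℂ) (s : ℕ) : cfSol ω q s 0 = 1 := by
  simp [cfSol, cfWeight, convSum, qPoch]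

theorem cfSol_one {ω q : ℂ} (hω : ω ≠ 0) (hq : ‖q‖ < 1) (s : ℕ) :
    cfSol ω q s 1 = ω + ω⁻¹ + q ^ s := by
  have h := congrArg (PowerSeries.coeff 1) (quadratic_mul_cfSeries hω hq s 1)
  rw [add_mul, sub_mul, one_mul, mul_assoc, map_add (PowerSeries.coeff _), map_sub,
    map_add (PowerSeries.coeff _), PowerSeries.coeff_C_mul,
    PowerSeries.coeff_C_mul, PowerSeries.coeff_X_pow_mul', PowerSeries.coeff_succ_X_mul,
    PowerSeries.coeff_succ_X_mul, PowerSeries.coeff_rescale, coeff_cfSeries _ _ _ (by omega),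
    coeff_cfSeries _ _ _ (by omega), coeff_cfSeries _ _ _ (by omega), cfSol_zero] at h
  simp [PowerSeries.coeff_one] at h
  linear_combination h

theorem cfSol_add_two {ω q : ℂ} (hω : ω ≠ 0) (hq : ‖q‖ < 1) (s n : ℕ) :
    cfSol ω q s (n + 2) = (ω + ω⁻¹ + q ^ (n + 1 + s)) * cfSol ω q s (n + 1) - cfSol ω q s n := by
  have h := congrArg (PowerSeries.coeff (n + 2)) (quadratic_mul_cfSeries hω hq s (n + 2))
  rw [add_mul, sub_mul, one_mul, mul_assoc, map_add (PowerSeries.coeff _), map_sub,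
    map_add (PowerSeries.coeff _), PowerSeries.coeff_C_mul,
    PowerSeries.coeff_C_mul, PowerSeries.coeff_X_pow_mul', PowerSeries.coeff_succ_X_mul,
    PowerSeries.coeff_succ_X_mul, PowerSeries.coeff_rescale, coeff_cfSeries _ _ _ (by omega),
    coeff_cfSeries _ _ _ (by omega), coeff_cfSeries _ _ _ (by omega), if_pos (by omega),
    coeff_cfSeries _ _ _ (by omega)] at h
  simp [PowerSeries.coeff_one] at h
  rw [pow_add]
  linear_combination h

/-! ### Numerators, denominators and their determinant -/

theorem ramanujanCF_get (ω q : ℂ) (n : ℕ) :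
    (ramanujanCF ω q).s.get? n =
      some ⟨if n = 0 then 1 else -1, ω + ω⁻¹ + q ^ (n + 1)⟩ := rfl

theorem ramanujanCF_dens {ω q : ℂ} (hω : ω ≠ 0) (hq : ‖q‖ < 1) (n : ℕ) :
    (ramanujanCF ω q).dens n = cfSol ω q 1 n := by
  induction n using Nat.twoStepInduction with
  | zero => rw [GenContFract.zeroth_den_eq_one, cfSol_zero]
  | one =>
    rw [GenContFract.first_den_eq (ramanujanCF_get ω q 0), cfSol_one hω hq]
  | more n h0 h1 =>
    rw [GenContFract.dens_recurrence (ramanujanCF_get ω q (n + 1)) rfl rfl, h0, h1,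
      cfSol_add_two hω hq]
    simp
    ring

/-- Numerators obey the same recurrence as denominators but start one index later, which raises `s`
from `1` to `2`. -/
theorem ramanujanCF_nums {ω q : ℂ} (hω : ω ≠ 0) (hq : ‖q‖ < 1) (n : ℕ) :
    (ramanujanCF ω q).nums (n + 1) = cfSol ω q 2 n := by
  have h0 : (ramanujanCF ω q).nums 0 = 0 := GenContFract.zeroth_num_eq_h
  have h1 : (ramanujanCF ω q).nums 1 = 1 := by
    rw [GenContFract.first_num_eq (ramanujanCF_get ω q 0)]
    simp [ramanujanCF]
  induction n using Nat.twoStepInduction with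
  | zero => rw [h1, cfSol_zero]
  | one =>
    rw [GenContFract.nums_recurrence (ramanujanCF_get ω q 1) rfl rfl, h0, h1, cfSol_one hω hq]
    simp
  | more n h0 h1 =>
    rw [GenContFract.nums_recurrence (ramanujanCF_get ω q (n + 2)) rfl rfl, h0, h1,
      cfSol_add_two hω hq]
    simp
    ring

theorem ramanujanCF_det (ω q : ℂ) (n : ℕ) :
    (ramanujanCF ω q).nums (n + 1) * (ramanujanCF ω q).dens n -
      (ramanujanCF ω q).nums n * (ramanujanCF ω q).dens (n + 1) = 1 := by
  induction n with
  | zero =>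
    rw [GenContFract.zeroth_den_eq_one, GenContFract.zeroth_num_eq_h,
      GenContFract.first_num_eq (ramanujanCF_get ω q 0)]
    simp [ramanujanCF]
  | succ n ih =>
    rw [GenContFract.nums_recurrence (ramanujanCF_get ω q (n + 1)) rfl rfl,
      GenContFract.dens_recurrence (ramanujanCF_get ω q (n + 1)) rfl rfl]
    simp
    linear_combination ih

/-! ### Norm estimates -/

theorem norm_qPoch_pow_le {q : ℂ} (hq : ‖q‖ < 1) (a j : ℕ) :
    ‖qPoch (q ^ (a + 1)) q j‖ ≤ 2 ^ j := by
  rw [qPoch, norm_prod, ← Finset.card_range j, ← Finset.prod_const, Finset.card_range]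
  refine Finset.prod_le_prod (fun _ _ => norm_nonneg _) fun k _ => ?_
  refine (norm_sub_le _ _).trans ?_
  rw [← pow_add, norm_pow, norm_one]
  linarith [pow_le_one₀ (n := a + 1 + k) (norm_nonneg q) hq.le]

theorem norm_qPoch_pow_sub_one_le {q : ℂ} (hq : ‖q‖ < 1) (a j : ℕ) :
    ‖qPoch (q ^ (a + 1)) q j - 1‖ ≤ 2 ^ j * ‖q‖ ^ a := by
  induction j with
  | zero => simp [qPoch]
  | succ j ih =>
    have h1 : qPoch (q ^ (a + 1)) q (j + 1) - 1 =
        (qPoch (q ^ (a + 1)) q j - 1) - qPoch (q ^ (a + 1)) q j * q ^ (a + 1 + j) := by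
      rw [qPoch_succ]; ring
    have h2 : ‖q ^ (a + 1 + j)‖ ≤ ‖q‖ ^ a := by
      rw [norm_pow]
      exact pow_le_pow_of_le_one (norm_nonneg q) hq.le (by omega)
    have h3 := mul_le_mul (norm_qPoch_pow_le hq a j) h2 (norm_nonneg _) (by positivity)
    rw [h1]
    refine (norm_sub_le _ _).trans ?_
    rw [norm_mul, pow_succ (2 : ℝ)]
    linarith

theorem one_sub_norm_pow_le_norm_qPoch_self {q : ℂ} (hq : ‖q‖ < 1) (j : ℕ) :
    (1 - ‖q‖) ^ j ≤ ‖qPoch q q j‖ := by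
  rw [qPoch, norm_prod]
  conv_lhs => rw [← Finset.card_range j, ← Finset.prod_const]
  refine Finset.prod_le_prod (fun _ _ => by linarith) fun k _ => ?_
  have h := norm_sub_norm_le (1 : ℂ) (q * q ^ k)
  rw [norm_mul, norm_pow, norm_one] at h
  have h2 := mul_le_mul_of_nonneg_left (pow_le_one₀ (n := k) (norm_nonneg q) hq.le)
    (norm_nonneg q)
  linarith

theorem summable_pow_choose_mul_pow {r : ℝ} (h0 : 0 ≤ r) (h1 : r < 1) {A : ℝ} (hA : 0 ≤ A) :
    Summable fun j : ℕ => r ^ (j + j.choose 2) * A ^ j := by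
  have ht : Tendsto (fun n : ℕ => r ^ (n + 1) * A) atTop (𝓝 0) := by
    simpa using ((tendsto_pow_atTop_nhds_zero_of_lt_one h0 h1).comp
      (tendsto_add_atTop_nat 1)).mul_const A
  refine summable_of_ratio_norm_eventually_le (r := 1 / 2) (by norm_num) ?_
  filter_upwards [ht.eventually_le_const (by norm_num : (0 : ℝ) < 1 / 2)] with n hn
  have he : r ^ (n + 1 + (n + 1).choose 2) * A ^ (n + 1) =
      (r ^ (n + 1) * A) * (r ^ (n + n.choose 2) * A ^ n) := by
    rw [Nat.choose_succ_succ' n 1, Nat.choose_one_right]; ring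
  rw [he, Real.norm_of_nonneg (by positivity), Real.norm_of_nonneg (by positivity)]
  exact mul_le_mul_of_nonneg_right hn (by positivity)

/-! ### Limits of the convolutions and of the folded sums -/

/-- The weight `ω^{2u-i} + ω^{i-2u}`. -/
def symWeight (ω : ℂ) (i : ℤ) (u : ℕ) : ℂ := ω ^ (2 * (u : ℤ) - i) + ω ^ (i - 2 * (u : ℤ))

theorem symWeight_congr {ω : ℂ} (hω : ω ≠ 0) {i i' : ℤ} (h : ω ^ i = ω ^ i') (u : ℕ) :
    symWeight ω i u = symWeight ω i' u := by
  simp only [symWeight, zpow_sub₀ hω, h]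

theorem norm_symWeight_le {ω : ℂ} (hω : ‖ω‖ = 1) (i : ℤ) (u : ℕ) : ‖symWeight ω i u‖ ≤ 2 := by
  refine (norm_add_le _ _).trans ?_
  rw [norm_zpow, norm_zpow, hω]
  norm_num

/-- The Chebyshev value `∑_{a + b = n} ω^{a-b}`. -/
def chebSum (ω : ℂ) (n : ℕ) : ℂ :=
  ∑ p ∈ Finset.HasAntidiagonal.antidiagonal n, ω ^ p.1 * ω⁻¹ ^ p.2

theorem chebSum_eq {ω : ℂ} (hω : ω - ω⁻¹ ≠ 0) (n : ℕ) :
    chebSum ω n = (ω ^ (n + 1) - ω⁻¹ ^ (n + 1)) / (ω - ω⁻¹) := by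
  rw [eq_div_iff hω, ← geom_sum₂_mul, chebSum,
    Finset.Nat.sum_antidiagonal_eq_sum_range_succ_mk]
  rfl

theorem chebSum_add_two {ω : ℂ} (hω : ω ≠ 0) (n : ℕ) :
    chebSum ω (n + 2) = chebSum ω n + (ω ^ (n + 2) + ω⁻¹ ^ (n + 2)) := by
  rw [chebSum, Finset.Nat.antidiagonal_succ_succ']
  simp only [Finset.sum_cons, Finset.sum_map, chebSum, Function.Embedding.prodMap,
    Function.Embedding.coeFn_mk, Prod.map, Nat.succ_eq_add_one, pow_zero]
  rw [Finset.sum_congr rfl (g := fun p : ℕ × ℕ => ω ^ p.1 * ω⁻¹ ^ p.2)]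
  · ring
  · intro p _
    rw [pow_succ, pow_succ]
    field_simp

/-- Pairing `(a, b)` with `(b, a)` folds the Chebyshev sum; for even `n` the middle pair is its own
mirror image and counts once. -/
theorem half_sum_eq_chebSum {ω : ℂ} (hω : ω ≠ 0) (n : ℕ) :
    ∑ u ∈ Finset.range (n / 2 + 1), (if 2 * u = n then 1 else symWeight ω n u) =
      chebSum ω n := by
  induction n using Nat.twoStepInduction with
  | zero => simp [chebSum]
  | one =>
    rw [chebSum, Finset.Nat.sum_antidiagonal_eq_sum_range_succ_mk]
    simp [symWeight, Finset.sum_range_succ]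
  | more n ih _ =>
    rw [chebSum_add_two hω, ← ih, show (n + 2) / 2 = n / 2 + 1 by omega,
      Finset.sum_range_succ']
    congr 1
    · refine Finset.sum_congr rfl fun u _ => ?_
      have h : 2 * (u + 1) = n + 2 ↔ 2 * u = n := by omega
      simp only [h, symWeight]
      push_cast
      congr 3 <;> ring
    · rw [if_neg (by omega), symWeight, inv_pow, ← zpow_natCast, ← zpow_neg]
      push_cast
      rw [add_comm]
      congr 2

/-- The common limit of `convSum ω q n j` and `F_k(ω, i, j, q)`. -/
def convLim (ω q : ℂ) (i : ℤ) (j : ℕ) : ℂ :=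
  (ω ^ (i + 1) - (ω ^ (i + 1))⁻¹) / (ω - ω⁻¹) +
    ∑' u : ℕ, (qPoch (q ^ (u + 1)) q j - 1) * symWeight ω i u

theorem summable_qPoch_sub_one_mul {ω q : ℂ} (hω : ‖ω‖ = 1) (hq : ‖q‖ < 1) (i : ℤ) (j : ℕ) :
    Summable fun u : ℕ => (qPoch (q ^ (u + 1)) q j - 1) * symWeight ω i u := by
  refine Summable.of_norm_bounded (g := fun u => 2 ^ j * ‖q‖ ^ u * 2)
    (((summable_geometric_of_lt_one (norm_nonneg q) hq).mul_left _).mul_right _) fun u => ?_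
  rw [norm_mul]
  exact mul_le_mul (norm_qPoch_pow_sub_one_le hq u j) (norm_symWeight_le hω i u)
    (norm_nonneg _) (by positivity)

theorem tendsto_qPoch_sub_one {q : ℂ} (hq : ‖q‖ < 1) (j : ℕ) :
    Tendsto (fun u : ℕ => qPoch (q ^ (u + 1)) q j - 1) atTop (𝓝 0) := by
  refine squeeze_zero_norm (fun u => norm_qPoch_pow_sub_one_le hq u j) ?_
  simpa using (tendsto_pow_atTop_nhds_zero_of_lt_one (norm_nonneg q) hq).const_mul (2 ^ j)

/-- Expand `xy = 1 + (x - 1) + (y - 1) + (x - 1)(y - 1)`; the two linear parts combine under the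
swap of coordinates. -/
theorem convSum_eq {ω : ℂ} (hω : ω ≠ 0) (q : ℂ) (n j : ℕ) :
    convSum ω q n j = chebSum ω n +
      ∑ u ∈ Finset.range (n + 1), (qPoch (q ^ (u + 1)) q j - 1) * symWeight ω n u +
      ∑ p ∈ Finset.HasAntidiagonal.antidiagonal n, (qPoch (q ^ (p.1 + 1)) q j - 1) *
        (qPoch (q ^ (p.2 + 1)) q j - 1) * (ω ^ p.1 * ω⁻¹ ^ p.2) := by
  have h1 : ∑ u ∈ Finset.range (n + 1), (qPoch (q ^ (u + 1)) q j - 1) * symWeight ω n u =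
      ∑ p ∈ Finset.HasAntidiagonal.antidiagonal n,
        (qPoch (q ^ (p.1 + 1)) q j - 1) * (ω ^ p.1 * ω⁻¹ ^ p.2) +
      ∑ p ∈ Finset.HasAntidiagonal.antidiagonal n,
        (qPoch (q ^ (p.2 + 1)) q j - 1) * (ω ^ p.1 * ω⁻¹ ^ p.2) := by
    rw [← Finset.Nat.sum_antidiagonal_swap (n := n)
      (f := fun p : ℕ × ℕ => (qPoch (q ^ (p.2 + 1)) q j - 1) * (ω ^ p.1 * ω⁻¹ ^ p.2)),
      ← Finset.sum_add_distrib, Finset.Nat.sum_antidiagonal_eq_sum_range_succ_mk]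
    refine Finset.sum_congr rfl fun u hu => ?_
    have hu' : u ≤ n := by rw [Finset.mem_range] at hu; omega
    have e1 : ω ^ (2 * (u : ℤ) - n) = ω ^ u * ω⁻¹ ^ (n - u) := by
      rw [inv_pow, ← zpow_natCast, ← zpow_natCast, ← zpow_neg, ← zpow_add₀ hω]
      congr 1; push_cast [hu']; ring
    have e2 : ω ^ ((n : ℤ) - 2 * (u : ℤ)) = ω ^ (n - u) * ω⁻¹ ^ u := by
      rw [inv_pow, ← zpow_natCast, ← zpow_natCast, ← zpow_neg, ← zpow_add₀ hω]
      congr 1; push_cast [hu']; ring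
    simp only [symWeight, e1, e2, Prod.fst_swap, Prod.snd_swap]
    ring
  rw [h1, chebSum, convSum, ← Finset.sum_add_distrib, ← Finset.sum_add_distrib,
    ← Finset.sum_add_distrib]
  exact Finset.sum_congr rfl fun p _ => by ring

theorem chebSum_of_pow_eq {ω : ℂ} (hω0 : ω ≠ 0) (hω : ω - ω⁻¹ ≠ 0) {n : ℕ} {i : ℤ}
    (h : ω ^ n = ω ^ i) :
    chebSum ω n = (ω ^ (i + 1) - (ω ^ (i + 1))⁻¹) / (ω - ω⁻¹) := by
  rw [chebSum_eq hω, inv_pow, pow_succ, h, zpow_add_one₀ hω0]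

theorem tendsto_sum_qPoch_sub_one_mul {ω q : ℂ} (hω : ‖ω‖ = 1) (hq : ‖q‖ < 1) {i : ℤ} (j : ℕ)
    {n N : ℕ → ℕ} (hN : Tendsto N atTop atTop) (h : ∀ᶠ k in atTop, ω ^ n k = ω ^ i) :
    Tendsto (fun k => ∑ u ∈ Finset.range (N k + 1),
        (qPoch (q ^ (u + 1)) q j - 1) * symWeight ω (n k) u) atTop
      (𝓝 (∑' u : ℕ, (qPoch (q ^ (u + 1)) q j - 1) * symWeight ω i u)) := by
  have hω0 : ω ≠ 0 := by rintro rfl; simp at hω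
  refine ((summable_qPoch_sub_one_mul hω hq i j).hasSum.tendsto_sum_nat.comp
    ((tendsto_add_atTop_nat 1).comp hN)).congr' ?_
  filter_upwards [h] with k hk
  refine Finset.sum_congr rfl fun u _ => ?_
  rw [symWeight_congr hω0 (i := n k) (i' := i) (by rw [zpow_natCast, hk])]

theorem tendsto_convSum {ω q : ℂ} (hω : ‖ω‖ = 1) (hω' : ω - ω⁻¹ ≠ 0) (hq : ‖q‖ < 1) {i : ℤ}
    (j : ℕ) {n : ℕ → ℕ} (hn : Tendsto n atTop atTop) (h : ∀ᶠ k in atTop, ω ^ n k = ω ^ i) :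
    Tendsto (fun k => convSum ω q (n k) j) atTop (𝓝 (convLim ω q i j)) := by
  have hω0 : ω ≠ 0 := by rintro rfl; simp at hω
  have h1 : Tendsto (fun k => chebSum ω (n k)) atTop
      (𝓝 ((ω ^ (i + 1) - (ω ^ (i + 1))⁻¹) / (ω - ω⁻¹))) :=
    tendsto_const_nhds.congr' (h.mono fun k hk => (chebSum_of_pow_eq hω0 hω' hk).symm)
  have h3 : Tendsto (fun n : ℕ => ∑ p ∈ Finset.HasAntidiagonal.antidiagonal n,
      (qPoch (q ^ (p.1 + 1)) q j - 1) * (qPoch (q ^ (p.2 + 1)) q j - 1) *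
        (ω ^ p.1 * ω⁻¹ ^ p.2)) atTop (𝓝 0) := by
    -- Each of the `n + 1` products is at most `4^j |q|^{a+b}` with `a + b = n`.
    refine squeeze_zero_norm (a := fun n : ℕ => 2 ^ j * 2 ^ j * ((n : ℝ) * ‖q‖ ^ n + ‖q‖ ^ n))
      (fun n => ?_) ?_
    · refine (norm_sum_le_of_le (n := fun _ => 2 ^ j * 2 ^ j * ‖q‖ ^ n) _
        fun p hp => ?_).trans
        (le_of_eq ?_)
      · rw [Finset.HasAntidiagonal.mem_antidiagonal] at hp
        rw [norm_mul, norm_mul, norm_mul, norm_pow, norm_pow, norm_inv, hω, ← hp, pow_add ‖q‖]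
        have := mul_le_mul (norm_qPoch_pow_sub_one_le hq p.1 j)
          (norm_qPoch_pow_sub_one_le hq p.2 j) (norm_nonneg _) (by positivity)
        simp only [inv_one, one_pow, mul_one]
        linarith
      · rw [Finset.sum_const, Finset.Nat.card_antidiagonal, nsmul_eq_mul]
        push_cast
        ring
    · simpa using ((tendsto_self_mul_const_pow_of_lt_one (norm_nonneg q) hq).add
        (tendsto_pow_atTop_nhds_zero_of_lt_one (norm_nonneg q) hq)).const_mul ((2 : ℝ) ^ j * 2 ^ j)
  have := (h1.add (tendsto_sum_qPoch_sub_one_mul hω hq j hn h)).add (h3.comp hn)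
  rw [add_zero] at this
  exact this.congr fun k => (convSum_eq hω0 q (n k) j).symm

theorem tendsto_half_sum {ω q : ℂ} (hω : ‖ω‖ = 1) (hω' : ω - ω⁻¹ ≠ 0) (hq : ‖q‖ < 1) {i : ℤ}
    (j : ℕ) {n : ℕ → ℕ} (hn : Tendsto n atTop atTop) (h : ∀ᶠ k in atTop, ω ^ n k = ω ^ i) :
    Tendsto (fun k => ∑ u ∈ Finset.range (n k / 2 + 1),
      if 2 * u = n k then qPoch (q ^ (u + 1)) q j
        else qPoch (q ^ (u + 1)) q j * symWeight ω (n k) u) atTop (𝓝 (convLim ω q i j)) := by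
  have hω0 : ω ≠ 0 := by rintro rfl; simp at hω
  have hn2 : Tendsto (fun k => n k / 2) atTop atTop :=
    (Nat.tendsto_div_const_atTop two_ne_zero).comp hn
  have h1 : Tendsto (fun k => chebSum ω (n k)) atTop
      (𝓝 ((ω ^ (i + 1) - (ω ^ (i + 1))⁻¹) / (ω - ω⁻¹))) :=
    tendsto_const_nhds.congr' (h.mono fun k hk => (chebSum_of_pow_eq hω0 hω' hk).symm)
  -- At `2u = n` the symmetric weight is `2`, whereas the folded sum counts the term once; the
  -- excess tends to zero.
  have h3 : Tendsto (fun k => if 2 * (n k / 2) = n k then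
      qPoch (q ^ (n k / 2 + 1)) q j - 1 else 0) atTop (𝓝 0) := by
    refine squeeze_zero_norm (fun k => ?_)
      (tendsto_zero_iff_norm_tendsto_zero.mp ((tendsto_qPoch_sub_one hq j).comp hn2))
    split_ifs
    · exact le_rfl
    · simp
  have := (h1.add (tendsto_sum_qPoch_sub_one_mul hω hq j hn2 h)).sub h3
  rw [sub_zero] at this
  refine this.congr fun k => ?_
  rw [← half_sum_eq_chebSum hω0]
  have h4 : (if 2 * (n k / 2) = n k then qPoch (q ^ (n k / 2 + 1)) q j - 1 else 0) =
      ∑ u ∈ Finset.range (n k / 2 + 1),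
        if 2 * u = n k then qPoch (q ^ (u + 1)) q j - 1 else 0 := by
    rw [Finset.sum_range_succ, Finset.sum_eq_zero, zero_add]
    intro u hu
    rw [Finset.mem_range] at hu
    rw [if_neg (by omega)]
  rw [h4, ← Finset.sum_add_distrib, ← Finset.sum_sub_distrib]
  refine Finset.sum_congr rfl fun u _ => ?_
  split_ifs with hu
  · have : symWeight ω (n k) u = 2 := by
      rw [← hu, symWeight]; push_cast; norm_num
    rw [this]; ring
  · ring

/-! ### Convergence of `F_k` -/

theorem mul_natCast_add_toNat {m : ℕ} (hm : 0 < m) (i : ℤ) {k : ℕ} (hk : i.natAbs ≤ k) :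
    (((m : ℤ) * k + i).toNat : ℤ) = (m : ℤ) * k + i := by
  have : (k : ℤ) ≤ m * k := by exact_mod_cast Nat.le_mul_of_pos_left k hm
  omega

theorem tendsto_mul_natCast_add_toNat {m : ℕ} (hm : 0 < m) (i : ℤ) :
    Tendsto (fun k : ℕ => ((m : ℤ) * k + i).toNat) atTop atTop := by
  refine tendsto_atTop_mono (fun k => ?_) (tendsto_sub_atTop_nat i.natAbs)
  have : (k : ℤ) ≤ m * k := by exact_mod_cast Nat.le_mul_of_pos_left k hm
  omega

theorem pow_toNat_eventually_eq {m : ℕ} (hm : 0 < m) {ω : ℂ} (hω : ω ^ m = 1) (i : ℤ) :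
    ∀ᶠ k : ℕ in atTop, ω ^ ((m : ℤ) * k + i).toNat = ω ^ i := by
  have hω0 : ω ≠ 0 := by rintro rfl; simp [hm.ne'] at hω
  filter_upwards [eventually_ge_atTop i.natAbs] with k hk
  rw [← zpow_natCast, mul_natCast_add_toNat hm i hk, zpow_add₀ hω0, zpow_mul, zpow_natCast,
    zpow_natCast, hω, one_pow, one_mul]

theorem Fpartial_eq {m : ℕ} (hm : 0 < m) {ω : ℂ} (hω0 : ω ≠ 0) (hω : ω ^ m = 1) (q : ℂ)
    (i : ℤ) (j : ℕ) {k : ℕ} (hk : i.natAbs ≤ k) :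
    Fpartial m ω i j q k =
      ∑ u ∈ Finset.range (((m : ℤ) * k + i).toNat / 2 + 1),
        if 2 * u = ((m : ℤ) * k + i).toNat then qPoch (q ^ (u + 1)) q j
        else qPoch (q ^ (u + 1)) q j * symWeight ω ((m : ℤ) * k + i).toNat u := by
  have h := mul_natCast_add_toNat hm i hk
  have hpow : ω ^ ((m : ℤ) * k + i) = ω ^ i := by
    rw [zpow_add₀ hω0, zpow_mul, zpow_natCast, zpow_natCast, hω, one_pow, one_mul]
  rw [Fpartial, h,
    show (((m : ℤ) * k + i) / 2 + 1).toNat = ((m : ℤ) * k + i).toNat / 2 + 1 by omega]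
  refine Finset.sum_congr rfl fun u _ => ?_
  have hiff : 2 * u = ((m : ℤ) * k + i).toNat ↔ 2 * (u : ℤ) = (m : ℤ) * k + i := by omega
  simp only [hiff]
  rw [symWeight_congr hω0 hpow, symWeight]

theorem tendsto_Fpartial {m : ℕ} (hm : 0 < m) {ω q : ℂ} (hω : ω ^ m = 1) (hω1 : ‖ω‖ = 1)
    (hω' : ω - ω⁻¹ ≠ 0) (hq : ‖q‖ < 1) (i : ℤ) (j : ℕ) :
    Tendsto (Fpartial m ω i j q) atTop (𝓝 (convLim ω q i j)) := by
  have hω0 : ω ≠ 0 := by rintro rfl; simp at hω1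
  refine (tendsto_half_sum hω1 hω' hq j (tendsto_mul_natCast_add_toNat hm i)
    (pow_toNat_eventually_eq hm hω i)).congr' ?_
  filter_upwards [eventually_ge_atTop i.natAbs] with k hk
  exact (Fpartial_eq hm hω0 hω q i j hk).symm

/-! ### Uniform bounds and dominated convergence -/

theorem norm_chebSum_le {ω : ℂ} (hω : ‖ω‖ = 1) (hω' : ω - ω⁻¹ ≠ 0) (n : ℕ) :
    ‖chebSum ω n‖ ≤ 2 / ‖ω - ω⁻¹‖ := by
  rw [chebSum_eq hω', norm_div]
  refine div_le_div_of_nonneg_right ((norm_sub_le _ _).trans ?_) (norm_nonneg _)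
  rw [norm_pow, norm_pow, norm_inv, hω]
  norm_num

/-- A uniform bound for `convSum`, up to the factor `4 ^ j`. -/
def convBound (ω q : ℂ) : ℝ := 2 / ‖ω - ω⁻¹‖ + 2 * (1 - ‖q‖)⁻¹

theorem convBound_nonneg (ω : ℂ) {q : ℂ} (hq : ‖q‖ < 1) : 0 ≤ convBound ω q := by
  have : 0 < 1 - ‖q‖ := by linarith
  unfold convBound
  positivity

theorem norm_convSum_le {ω q : ℂ} (hω : ‖ω‖ = 1) (hω' : ω - ω⁻¹ ≠ 0) (hq : ‖q‖ < 1) (n j : ℕ) :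
    ‖convSum ω q n j‖ ≤ convBound ω q * 4 ^ j := by
  have h4 : (4 : ℝ) ^ j = 2 ^ j * 2 ^ j := by rw [← mul_pow]; norm_num
  have h41 : (1 : ℝ) ≤ 4 ^ j := one_le_pow₀ (by norm_num)
  have hgeom : ∑ u ∈ Finset.range (n + 1), ‖q‖ ^ u ≤ (1 - ‖q‖)⁻¹ := by
    rw [← tsum_geometric_of_lt_one (norm_nonneg q) hq]
    exact (summable_geometric_of_lt_one (norm_nonneg q) hq).sum_le_tsum _
      fun _ _ => by positivity
  have hdiff : ‖convSum ω q n j - chebSum ω n‖ ≤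
      ∑ p ∈ Finset.HasAntidiagonal.antidiagonal n, 4 ^ j * (‖q‖ ^ p.1 + ‖q‖ ^ p.2) := by
    rw [convSum, chebSum, ← Finset.sum_sub_distrib]
    refine norm_sum_le_of_le _ fun p _ => ?_
    set x := qPoch (q ^ (p.1 + 1)) q j
    set y := qPoch (q ^ (p.2 + 1)) q j
    -- Each deviation from `1` carries a factor `|q|^a` or `|q|^b`, so the difference from the
    -- Chebyshev sum is bounded by geometric series, uniformly in `n`.
    have e : x * y * (ω ^ p.1 * ω⁻¹ ^ p.2) - ω ^ p.1 * ω⁻¹ ^ p.2 =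
        ((x - 1) * y + (y - 1)) * (ω ^ p.1 * ω⁻¹ ^ p.2) := by ring
    rw [e, norm_mul, norm_mul, norm_pow, norm_pow, norm_inv, hω]
    simp only [inv_one, one_pow, mul_one]
    refine (norm_add_le _ _).trans ?_
    rw [norm_mul, mul_add]
    have hx : ‖x - 1‖ ≤ 2 ^ j * ‖q‖ ^ p.1 := norm_qPoch_pow_sub_one_le hq p.1 j
    have hy : ‖y - 1‖ ≤ 2 ^ j * ‖q‖ ^ p.2 := norm_qPoch_pow_sub_one_le hq p.2 j
    have hy' : ‖y‖ ≤ 2 ^ j := norm_qPoch_pow_le hq p.2 j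
    refine add_le_add ?_ (hy.trans ?_)
    · refine (mul_le_mul hx hy' (norm_nonneg _) (by positivity)).trans (le_of_eq ?_)
      rw [h4]; ring
    · exact mul_le_mul_of_nonneg_right (pow_le_pow_left₀ (by norm_num) (by norm_num) j)
        (by positivity)
  have hsum : ∑ p ∈ Finset.HasAntidiagonal.antidiagonal n, (‖q‖ ^ p.1 + ‖q‖ ^ p.2) =
      2 * ∑ u ∈ Finset.range (n + 1), ‖q‖ ^ u := by
    rw [Finset.sum_add_distrib, ← Finset.Nat.sum_antidiagonal_swap (f := fun p => ‖q‖ ^ p.2)]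
    simp only [Prod.snd_swap]
    rw [Finset.Nat.sum_antidiagonal_eq_sum_range_succ_mk, two_mul]
  rw [← Finset.mul_sum, hsum] at hdiff
  calc ‖convSum ω q n j‖ = ‖chebSum ω n + (convSum ω q n j - chebSum ω n)‖ := by congr 1; ring
    _ ≤ 2 / ‖ω - ω⁻¹‖ * 4 ^ j + 4 ^ j * (2 * (1 - ‖q‖)⁻¹) := by
        refine (norm_add_le _ _).trans (add_le_add ?_ (hdiff.trans ?_))
        · exact (norm_chebSum_le hω hω' n).trans (le_mul_of_one_le_right (by positivity) h41)
        · gcongr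
    _ = convBound ω q * 4 ^ j := by rw [convBound]; ring

theorem norm_convLim_le {m : ℕ} (hm : 0 < m) {ω q : ℂ} (hω : ω ^ m = 1) (hω1 : ‖ω‖ = 1)
    (hω' : ω - ω⁻¹ ≠ 0) (hq : ‖q‖ < 1) (i : ℤ) (j : ℕ) :
    ‖convLim ω q i j‖ ≤ convBound ω q * 4 ^ j :=
  le_of_tendsto (tendsto_convSum hω1 hω' hq j (tendsto_mul_natCast_add_toNat hm i)
    (pow_toNat_eventually_eq hm hω i)).norm (Eventually.of_forall fun _ =>
      norm_convSum_le hω1 hω' hq _ j)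

theorem norm_cfWeight_le {q : ℂ} (hq : ‖q‖ < 1) {s : ℕ} (hs : 1 ≤ s) (j : ℕ) :
    ‖cfWeight q s j‖ ≤ ‖q‖ ^ (j + j.choose 2) * ((1 - ‖q‖)⁻¹ ^ 2) ^ j := by
  have h0 : 0 < 1 - ‖q‖ := by linarith
  rw [cfWeight, norm_div, norm_pow, norm_pow, div_eq_mul_inv]
  have h1 : ‖q‖ ^ (s * j + j.choose 2) ≤ ‖q‖ ^ (j + j.choose 2) :=
    pow_le_pow_of_le_one (norm_nonneg q) hq.le (by gcongr; exact Nat.le_mul_of_pos_left j hs)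
  have h2 : (‖qPoch q q j‖ ^ 2)⁻¹ ≤ ((1 - ‖q‖)⁻¹ ^ 2) ^ j := by
    rw [← pow_mul, inv_pow, mul_comm 2 j, pow_mul]
    exact inv_anti₀ (by positivity)
      (pow_le_pow_left₀ (by positivity) (one_sub_norm_pow_le_norm_qPoch_self hq j) 2)
  exact mul_le_mul h1 h2 (by positivity) (by positivity)

theorem norm_cfWeight_mul_le {ω q : ℂ} (hq : ‖q‖ < 1) {s : ℕ} (hs : 1 ≤ s) {j : ℕ} {z : ℂ}
    (hz : ‖z‖ ≤ convBound ω q * 4 ^ j) :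
    ‖cfWeight q s j * z‖ ≤
      convBound ω q * (‖q‖ ^ (j + j.choose 2) * (4 * (1 - ‖q‖)⁻¹ ^ 2) ^ j) := by
  rw [norm_mul]
  refine (mul_le_mul (norm_cfWeight_le hq hs j) hz (norm_nonneg _) (by positivity)).trans
    (le_of_eq ?_)
  rw [mul_pow 4]; ring

theorem summable_cfBound (ω : ℂ) {q : ℂ} (hq : ‖q‖ < 1) :
    Summable fun j : ℕ =>
      convBound ω q * (‖q‖ ^ (j + j.choose 2) * (4 * (1 - ‖q‖)⁻¹ ^ 2) ^ j) :=
  (summable_pow_choose_mul_pow (norm_nonneg q) hq (by positivity)).mul_left _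

/-- The limit of `cfSol ω q s` along the `n` with `ω ^ n = ω ^ i`. -/
def cfLim (ω q : ℂ) (s : ℕ) (i : ℤ) : ℂ := ∑' j : ℕ, cfWeight q s j * convLim ω q (i - j) j

theorem summable_cfLim {m : ℕ} (hm : 0 < m) {ω q : ℂ} (hω : ω ^ m = 1) (hω1 : ‖ω‖ = 1)
    (hω' : ω - ω⁻¹ ≠ 0) (hq : ‖q‖ < 1) {s : ℕ} (hs : 1 ≤ s) (i : ℤ) :
    Summable fun j : ℕ => cfWeight q s j * convLim ω q (i - j) j :=
  (summable_cfBound ω hq).of_norm_bounded fun j =>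
    norm_cfWeight_mul_le hq hs (norm_convLim_le hm hω hω1 hω' hq _ j)

/-- Tannery's theorem: extend the finite sum by zeros and dominate it by a bound in which
`|q|^{j(j+1)/2}` beats every exponential in `j`. -/
theorem tendsto_cfSol {ω q : ℂ} (hω : ‖ω‖ = 1) (hω' : ω - ω⁻¹ ≠ 0) (hq : ‖q‖ < 1) {s : ℕ}
    (hs : 1 ≤ s) {i : ℤ} {n : ℕ → ℕ} (hn : Tendsto n atTop atTop)
    (h : ∀ᶠ k in atTop, ω ^ n k = ω ^ i) :
    Tendsto (fun k => cfSol ω q s (n k)) atTop (𝓝 (cfLim ω q s i)) := by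
  have hω0 : ω ≠ 0 := by rintro rfl; simp at hω
  have heq : ∀ k, cfSol ω q s (n k) =
      ∑' j : ℕ, if j ≤ n k then cfWeight q s j * convSum ω q (n k - j) j else 0 := by
    intro k
    rw [tsum_eq_sum (s := Finset.range (n k + 1)), cfSol]
    · refine Finset.sum_congr rfl fun j hj => ?_
      rw [Finset.mem_range] at hj
      rw [if_pos (by omega)]
    · intro j hj
      rw [Finset.mem_range] at hj
      rw [if_neg (by omega)]
  simp only [heq]
  refine tendsto_tsum_of_dominated_convergence (summable_cfBound ω hq) (fun j => ?_)
    (Eventually.of_forall fun k j => ?_)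
  · have hpow : ∀ᶠ k in atTop, ω ^ (n k - j) = ω ^ (i - j) := by
      filter_upwards [h, hn.eventually_ge_atTop j] with k hk hj
      rw [pow_sub₀ _ hω0 hj, hk, zpow_sub₀ hω0, zpow_natCast, div_eq_mul_inv]
    refine ((tendsto_convSum hω hω' hq j ((tendsto_sub_atTop_nat j).comp hn)
      hpow).const_mul (cfWeight q s j)).congr' ?_
    filter_upwards [hn.eventually_ge_atTop j] with k hj
    rw [if_pos hj]
    rfl
  · split_ifs
    · exact norm_cfWeight_mul_le hq hs (norm_convSum_le hω hω' hq _ j)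
    · rw [norm_zero]
      have := convBound_nonneg ω hq
      positivity

/-! ### Limits along residue classes and their determinants -/

theorem tendsto_dens {ω q : ℂ} (hω : ‖ω‖ = 1) (hω' : ω - ω⁻¹ ≠ 0) (hq : ‖q‖ < 1) {i : ℤ}
    {n : ℕ → ℕ} (hn : Tendsto n atTop atTop) (h : ∀ᶠ k in atTop, ω ^ n k = ω ^ i) :
    Tendsto (fun k => (ramanujanCF ω q).dens (n k)) atTop (𝓝 (cfLim ω q 1 i)) := by
  have hω0 : ω ≠ 0 := by rintro rfl; simp at hω
  simp only [ramanujanCF_dens hω0 hq]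
  exact tendsto_cfSol hω hω' hq le_rfl hn h

theorem tendsto_nums {ω q : ℂ} (hω : ‖ω‖ = 1) (hω' : ω - ω⁻¹ ≠ 0) (hq : ‖q‖ < 1) {i : ℤ}
    {n : ℕ → ℕ} (hn : Tendsto n atTop atTop) (h : ∀ᶠ k in atTop, ω ^ n k = ω ^ i) :
    Tendsto (fun k => (ramanujanCF ω q).nums (n k)) atTop (𝓝 (cfLim ω q 2 (i - 1))) := by
  have hω0 : ω ≠ 0 := by rintro rfl; simp at hω
  have hpow : ∀ᶠ k in atTop, ω ^ (n k - 1) = ω ^ (i - 1) := by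
    filter_upwards [h, hn.eventually_ge_atTop 1] with k hk h1
    rw [pow_sub₀ _ hω0 h1, hk, zpow_sub₀ hω0, zpow_one, pow_one, div_eq_mul_inv]
  refine (tendsto_cfSol hω hω' hq one_le_two ((tendsto_sub_atTop_nat 1).comp hn) hpow).congr' ?_
  filter_upwards [hn.eventually_ge_atTop 1] with k h1
  rw [← ramanujanCF_nums hω0 hq, Function.comp_apply, Nat.sub_add_cancel h1]

theorem det_cfLim_one {m : ℕ} (hm : 0 < m) {ω q : ℂ} (hω : ω ^ m = 1) (hω1 : ‖ω‖ = 1)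
    (hω' : ω - ω⁻¹ ≠ 0) (hq : ‖q‖ < 1) (i : ℤ) :
    cfLim ω q 2 i * cfLim ω q 1 i - cfLim ω q 2 (i - 1) * cfLim ω q 1 (i + 1) = 1 := by
  have hω0 : ω ≠ 0 := by rintro rfl; simp at hω1
  have hn := tendsto_mul_natCast_add_toNat hm i
  have hp := pow_toNat_eventually_eq hm hω i
  have hn' := (tendsto_add_atTop_nat 1).comp hn
  have hp' : ∀ᶠ k : ℕ in atTop, ω ^ (((m : ℤ) * k + i).toNat + 1) = ω ^ (i + 1) := by
    filter_upwards [hp] with k hk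
    rw [pow_succ, hk, zpow_add_one₀ hω0]
  have h1 := ((tendsto_nums hω1 hω' hq hn' hp').mul (tendsto_dens hω1 hω' hq hn hp)).sub
    ((tendsto_nums hω1 hω' hq hn hp).mul (tendsto_dens hω1 hω' hq hn' hp'))
  rw [add_sub_cancel_right] at h1
  exact tendsto_nhds_unique h1 (tendsto_const_nhds.congr fun k => (ramanujanCF_det ω q _).symm)

/-- The term `q^{n+1+s}` of the recurrence tends to `0`, leaving constant coefficients. -/
theorem cfLim_add_two {m : ℕ} (hm : 0 < m) {ω q : ℂ} (hω : ω ^ m = 1) (hω1 : ‖ω‖ = 1)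
    (hω' : ω - ω⁻¹ ≠ 0) (hq : ‖q‖ < 1) {s : ℕ} (hs : 1 ≤ s) (i : ℤ) :
    cfLim ω q s (i + 2) = (ω + ω⁻¹) * cfLim ω q s (i + 1) - cfLim ω q s i := by
  have hω0 : ω ≠ 0 := by rintro rfl; simp at hω1
  have hn := tendsto_mul_natCast_add_toNat hm i
  have hp := pow_toNat_eventually_eq hm hω i
  have hn' := fun l : ℕ => (tendsto_add_atTop_nat l).comp hn
  have hp' : ∀ l : ℕ, ∀ᶠ k : ℕ in atTop, ω ^ (((m : ℤ) * k + i).toNat + l) = ω ^ (i + l) := by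
    intro l
    filter_upwards [hp] with k hk
    rw [pow_add, hk, zpow_add₀ hω0, zpow_natCast]
  have hqt : Tendsto (fun k : ℕ => q ^ (((m : ℤ) * k + i).toNat + (1 + s))) atTop (𝓝 0) :=
    (tendsto_pow_atTop_nhds_zero_of_norm_lt_one hq).comp (hn' (1 + s))
  have h2 := tendsto_cfSol hω1 hω' hq hs (hn' 2) (hp' 2)
  have h1 := ((hqt.const_add (ω + ω⁻¹)).mul (tendsto_cfSol hω1 hω' hq hs (hn' 1) (hp' 1))).sub
    (tendsto_cfSol hω1 hω' hq hs hn hp)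
  rw [add_zero] at h1
  refine tendsto_nhds_unique h2 (h1.congr fun k => ?_)
  simp only [Function.comp_apply]
  rw [cfSol_add_two hω0 hq, add_assoc (Int.toNat _) 1 s]

/-- As a function of `l` the determinant satisfies the limiting recurrence with values `0` and `1`
at `l = 0, 1`, hence is a Chebyshev value. -/
theorem det_cfLim {m : ℕ} (hm : 0 < m) {ω q : ℂ} (hω : ω ^ m = 1) (hω1 : ‖ω‖ = 1)
    (hω' : ω - ω⁻¹ ≠ 0) (hq : ‖q‖ < 1) (i : ℤ) (l : ℕ) :
    (cfLim ω q 2 (i + l - 1) * cfLim ω q 1 i - cfLim ω q 2 (i - 1) * cfLim ω q 1 (i + l)) *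
      (ω - ω⁻¹) = ω ^ l - ω⁻¹ ^ l := by
  have hω0 : ω ≠ 0 := by rintro rfl; simp at hω1
  induction l using Nat.twoStepInduction with
  | zero => simp
  | one =>
    have := det_cfLim_one hm hω hω1 hω' hq i
    push_cast
    rw [add_sub_cancel_right, this]; ring
  | more l h0 h1 =>
    have e2 := cfLim_add_two hm hω hω1 hω' hq one_le_two (i + l - 1)
    have e1 := cfLim_add_two hm hω hω1 hω' hq le_rfl (i + l)
    push_cast at h0 h1 ⊢
    rw [show i + (l + 2 : ℤ) - 1 = i + l - 1 + 2 by ring, ← add_assoc, e1, e2]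
    rw [show i + (l + 1 : ℤ) - 1 = i + l - 1 + 1 by ring, ← add_assoc] at h1
    have : ω * ω⁻¹ = 1 := mul_inv_cancel₀ hω0
    linear_combination (ω + ω⁻¹) * h1 - h0 + (ω ^ l - ω⁻¹ ^ l) * this

/-! ### Quotients in the extended plane -/

theorem tendsto_extDiv {f g : ℕ → ℂ} {a b : ℂ} (hf : Tendsto f atTop (𝓝 a))
    (hg : Tendsto g atTop (𝓝 b)) (h : ¬ (a = 0 ∧ b = 0)) :
    Tendsto (fun k => extDiv (f k) (g k)) atTop (𝓝 (extDiv a b)) := by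
  by_cases hb : b = 0
  · have ha : a ≠ 0 := fun ha => h ⟨ha, hb⟩
    subst hb
    -- Near `∞` one works with the reciprocal: `g / f → 0`, and inversion carries punctured
    -- neighbourhoods of `0` to neighbourhoods of `∞`.
    have hinv : Tendsto (fun k => g k / f k) atTop (𝓝 0) := by
      have := hg.div hf ha
      rwa [zero_div] at this
    rw [extDiv, if_pos rfl, OnePoint.nhds_infty_eq, tendsto_def]
    intro s hs
    rw [mem_sup, mem_map, mem_pure, coclosedCompact_eq_cocompact,
      ← Metric.cobounded_eq_cocompact, ← inv_nhdsNE_zero] at hs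
    obtain ⟨hs1, hs2⟩ := hs
    rw [Filter.mem_inv, mem_nhdsWithin_iff_eventually] at hs1
    filter_upwards [hinv.eventually hs1, hf.eventually_ne ha] with k hk hfk
    rw [Set.mem_preimage, extDiv]
    split_ifs with hgk
    · exact hs2
    · have := hk (by simpa using ⟨hgk, hfk⟩)
      simpa using this
  · have h1 : Tendsto (fun k => ((f k / g k : ℂ) : OnePoint ℂ)) atTop
        (𝓝 ((a / b : ℂ) : OnePoint ℂ)) :=
      (OnePoint.continuous_coe.tendsto _).comp (hf.div hg hb)
    rw [extDiv, if_neg hb]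
    refine h1.congr' ?_
    filter_upwards [hg.eventually_ne hb] with k hk
    rw [extDiv, if_neg hk]

theorem extDiv_eq_iff {a b c d : ℂ} (h : ¬ (a = 0 ∧ b = 0)) (h' : ¬ (c = 0 ∧ d = 0)) :
    extDiv a b = extDiv c d ↔ a * d - c * b = 0 := by
  unfold extDiv
  split_ifs with hb hd hd
  · simp [hb, hd]
  · have ha : a ≠ 0 := fun ha => h ⟨ha, hb⟩
    simp [hb, hd, ha]
  · have hc : c ≠ 0 := fun hc => h' ⟨hc, hd⟩
    simp [hb, hd, hc]
  · rw [OnePoint.coe_eq_coe, div_eq_div_iff hb hd, sub_eq_zero]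

theorem tendsto_of_tendsto_even_odd {X : Type*} {f : ℕ → X} {l : Filter X}
    (h0 : Tendsto (fun k => f (2 * k)) atTop l) (h1 : Tendsto (fun k => f (2 * k + 1)) atTop l) :
    Tendsto f atTop l := by
  intro s hs
  obtain ⟨a, ha⟩ := eventually_atTop.mp (h0.eventually hs)
  obtain ⟨b, hb⟩ := eventually_atTop.mp (h1.eventually hs)
  refine eventually_atTop.mpr ⟨2 * a + 2 * b + 1, fun n hn => ?_⟩
  rcases Nat.even_or_odd' n with ⟨k, rfl | rfl⟩
  · exact ha k (by omega)
  · exact hb k (by omega)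

/-! ### Limits of approximants and rank -/

theorem cfLim_ne_zero {m : ℕ} (hm : 0 < m) {ω q : ℂ} (hω : ω ^ m = 1) (hω1 : ‖ω‖ = 1)
    (hω' : ω - ω⁻¹ ≠ 0) (hq : ‖q‖ < 1) (i : ℤ) :
    ¬ (cfLim ω q 2 (i - 1) = 0 ∧ cfLim ω q 1 i = 0) := by
  rintro ⟨h1, h2⟩
  have := det_cfLim_one hm hω hω1 hω' hq i
  rw [h1, h2] at this
  simp at this

theorem tendsto_approximant {m : ℕ} (hm : 0 < m) {ω q : ℂ} (hω : ω ^ m = 1) (hω1 : ‖ω‖ = 1)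
    (hω' : ω - ω⁻¹ ≠ 0) (hq : ‖q‖ < 1) {i : ℤ} {n : ℕ → ℕ} (hn : Tendsto n atTop atTop)
    (h : ∀ᶠ k in atTop, ω ^ n k = ω ^ i) :
    Tendsto (fun k => approximant (ramanujanCF ω q) (n k)) atTop
      (𝓝 (extDiv (cfLim ω q 2 (i - 1)) (cfLim ω q 1 i))) :=
  tendsto_extDiv (tendsto_nums hω1 hω' hq hn h) (tendsto_dens hω1 hω' hq hn h)
    (cfLim_ne_zero hm hω hω1 hω' hq i)

/-- Equality means a vanishing cross determinant, that is `ω^l = ω^{-l}`, or `ω^{2l} = 1`. -/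
theorem extDiv_cfLim_add_eq_iff {m : ℕ} (hm : 0 < m) {ω q : ℂ} (hω : IsPrimitiveRoot ω m)
    (hω1 : ‖ω‖ = 1) (hω' : ω - ω⁻¹ ≠ 0) (hq : ‖q‖ < 1) (i : ℤ) (l : ℕ) :
    extDiv (cfLim ω q 2 (i + l - 1)) (cfLim ω q 1 (i + l)) =
      extDiv (cfLim ω q 2 (i - 1)) (cfLim ω q 1 i) ↔ m ∣ 2 * l := by
  have hω0 : ω ≠ 0 := by rintro rfl; simp at hω1
  rw [extDiv_eq_iff (cfLim_ne_zero hm hω.pow_eq_one hω1 hω' hq _)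
    (cfLim_ne_zero hm hω.pow_eq_one hω1 hω' hq _), ← hω.pow_eq_one_iff_dvd,
    ← mul_left_inj' hω', det_cfLim hm hω.pow_eq_one hω1 hω' hq, zero_mul, sub_eq_zero, inv_pow,
    ← div_eq_one_iff_eq (inv_ne_zero (pow_ne_zero l hω0)), div_inv_eq_mul, ← pow_add, two_mul]

theorem hasRank_ramanujanCF {m r : ℕ} (hm : 0 < m) (hr : 0 < r) {ω q : ℂ}
    (hω : IsPrimitiveRoot ω m) (hω1 : ‖ω‖ = 1) (hω' : ω - ω⁻¹ ≠ 0) (hq : ‖q‖ < 1)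
    (hdvd : ∀ l, 0 < l → l < r → ¬ m ∣ 2 * l)
    (hlim : ∀ i : ℕ, Tendsto (fun k : ℕ => approximant (ramanujanCF ω q) (r * k + i)) atTop
      (𝓝 (extDiv (cfLim ω q 2 (i - 1)) (cfLim ω q 1 i)))) :
    HasRank (ramanujanCF ω q) r := by
  refine ⟨hr, fun i => extDiv (cfLim ω q 2 ((i : ℕ) - 1)) (cfLim ω q 1 (i : ℕ)), ?_,
    fun i => hlim i⟩
  refine Function.Injective.of_lt_imp_ne (fun i j hij h => ?_)
  refine hdvd (j - i : ℕ) (by omega) (by omega)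
    ((extDiv_cfLim_add_eq_iff hm hω hω1 hω' hq (i : ℕ) _).mp ?_)
  rw [Nat.cast_sub (by omega), add_sub_cancel]
  exact h.symm

/-! ### Matching the stated series -/

theorem numTerm_eq {m : ℕ} {ω q : ℂ}
    (hF : ∀ (i : ℤ) (j : ℕ), Flim m ω i j q = convLim ω q i j) (i : ℤ) :
    numTerm m ω q i = fun j : ℕ => cfWeight q 2 j * convLim ω q (i - 2 - j) j := by
  funext j
  have he : j * (j + 3) / 2 = 2 * j + j.choose 2 := by
    have h : (j + 1).choose 2 = j + j.choose 2 := by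
      rw [Nat.choose_succ_succ' j 1, Nat.choose_one_right]
    rw [Nat.choose_two_right, Nat.add_sub_cancel] at h
    rw [show j * (j + 3) = (j + 1) * j + j * 2 by ring, Nat.add_mul_div_right _ _ two_pos, h]
    ring
  rw [numTerm, hF, cfWeight, he, sub_right_comm]

theorem denTerm_eq {m : ℕ} {ω q : ℂ}
    (hF : ∀ (i : ℤ) (j : ℕ), Flim m ω i j q = convLim ω q i j) (i : ℤ) :
    denTerm m ω q i = fun j : ℕ => cfWeight q 1 j * convLim ω q (i - 1 - j) j := by
  funext j
  have he : j * (j + 1) / 2 = 1 * j + j.choose 2 := by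
    have h : (j + 1).choose 2 = j + j.choose 2 := by
      rw [Nat.choose_succ_succ' j 1, Nat.choose_one_right]
    rw [Nat.choose_two_right, Nat.add_sub_cancel] at h
    rw [mul_comm j, h, one_mul]
  rw [denTerm, hF, cfWeight, he, sub_right_comm]

end

theorem theorem4 (m : ℕ) (hm : 2 < m) (ω : ℂ) (hω : IsPrimitiveRoot ω m) (q : ℂ) (hq : ‖q‖ < 1) :
    (∀ (i : ℤ) (j : ℕ), Tendsto (Fpartial m ω i j q) atTop (𝓝 (Flim m ω i j q))) ∧
    (∀ i : ℕ, 1 ≤ i → i ≤ m →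
      Summable (numTerm m ω q i) ∧ Summable (denTerm m ω q i) ∧
      ¬ (∑' j : ℕ, numTerm m ω q i j = 0 ∧ ∑' j : ℕ, denTerm m ω q i j = 0) ∧
      Tendsto (fun k : ℕ => approximant (ramanujanCF ω q) (m * k + i - 1)) atTop
        (𝓝 (extDiv (∑' j : ℕ, numTerm m ω q i j) (∑' j : ℕ, denTerm m ω q i j)))) ∧
    (Odd m → HasRank (ramanujanCF ω q) m) ∧
    (Even m → HasRank (ramanujanCF ω q) (m / 2)) := by
  have hm0 : 0 < m := by omega
  have hpow := hω.pow_eq_one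
  have hω1 : ‖ω‖ = 1 := hω.norm'_eq_one hm0.ne'
  have hω0 : ω ≠ 0 := hω.ne_zero hm0.ne'
  have hω' : ω - ω⁻¹ ≠ 0 := by
    intro h
    have h2 : ω ^ 2 = 1 := by
      rw [sq]
      nth_rewrite 2 [sub_eq_zero.mp h]
      exact mul_inv_cancel₀ hω0
    exact absurd (Nat.le_of_dvd two_pos ((hω.pow_eq_one_iff_dvd 2).mp h2)) (by omega)
  have hFt := fun i j => tendsto_Fpartial hm0 hpow hω1 hω' hq i j
  have hF : ∀ (i : ℤ) (j : ℕ), Flim m ω i j q = convLim ω q i j :=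
    fun i j => (hFt i j).limUnder_eq
  have hmk : Tendsto (fun k : ℕ => m * k) atTop atTop := tendsto_id.const_mul_atTop' hm0
  have hlim : ∀ i : ℕ, Tendsto (fun k : ℕ => approximant (ramanujanCF ω q) (m * k + i)) atTop
      (𝓝 (extDiv (cfLim ω q 2 (i - 1)) (cfLim ω q 1 i))) := fun i =>
    tendsto_approximant hm0 hpow hω1 hω' hq ((tendsto_add_atTop_nat i).comp hmk)
      (Eventually.of_forall fun k => by
        rw [pow_add, pow_mul, hpow, one_pow, one_mul, zpow_natCast])
  refine ⟨fun i j => by rw [hF]; exact hFt i j, fun i hi _ => ?_, fun hodd => ?_, fun heven => ?_⟩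
  · have hi' : ((i - 1 : ℕ) : ℤ) = (i : ℤ) - 1 := by omega
    have e : (i : ℤ) - 2 = i - 1 - 1 := by ring
    -- The index `mk + i - 1` lies in class `i - 1`, and numerators lag by one more, whence `i - 2`
    -- in the numerator series.
    have hl := hlim (i - 1)
    rw [hi'] at hl
    rw [numTerm_eq hF, denTerm_eq hF, e]
    refine ⟨summable_cfLim hm0 hpow hω1 hω' hq one_le_two _,
      summable_cfLim hm0 hpow hω1 hω' hq le_rfl _,
      cfLim_ne_zero hm0 hpow hω1 hω' hq (i - 1), ?_⟩
    simp only [Nat.add_sub_assoc hi]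
    exact hl
  · refine hasRank_ramanujanCF hm0 hm0 hω hω1 hω' hq (fun l h0 h1 h => ?_) hlim
    exact absurd (Nat.le_of_dvd h0 (hodd.coprime_two_right.dvd_of_dvd_mul_left h)) (by omega)
  · obtain ⟨h, rfl⟩ := heven
    rw [show (h + h) / 2 = h by omega]
    refine hasRank_ramanujanCF hm0 (by omega) hω hω1 hω' hq (fun l h0 h1 hd => ?_) fun i => ?_
    · exact absurd (Nat.le_of_dvd (by omega) hd) (by omega)
    -- With `m = 2h`, a class modulo `h` is the union of classes `i` and `i + h` modulo `m`, whose
    -- limits agree because `m ∣ 2h`.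
    · refine tendsto_of_tendsto_even_odd ?_ ?_
      · refine (hlim i).congr fun k => ?_
        congr 1; ring
      · have hl := hlim (i + h)
        push_cast at hl
        rw [(extDiv_cfLim_add_eq_iff hm0 hω hω1 hω' hq i h).mpr (by rw [two_mul])] at hl
        refine hl.congr fun k => ?_
        congr 1; ring
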